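/- For $d\ge 1$ let $\mathcal F_d(\Delta,L_1)$ be the set of $F\in C^1(\mathbb R^d,\mathbb R)$ that are bounded below, satisfy $F(0)-\inf F\le\Delta$, and have $\|\nabla F(x)-\nabla F(y)\|\le L_1\|x-y\|$ for all $x,y$ (Euclidean norm). For such $F$ let $\mathcal O(F)$ be the set of pairs of a probability distribution $\mathbb P_\xi$ on a measurable space and a jointly measurable map $g(x,\xi)\in\mathbb R^d$ such that for all $x,y\in\mathbb R^d$ $$\mathbb E\,g(x,\xi)=\nabla F(x),\qquad \mathbb E\|g(x,\xi)-\nabla F(x)\|^p\le\sigma_1^p,$$ $$\mathbb E\big\|[g(x,\xi)-g(y,\xi)]-[\nabla F(x)-\nabla F(y)]\big\|^q\le\delta^q\|x-y\|^q .$$ An algorithm draws a random seed $r$ once; in round $i=1,2,\dots$ it issues, as a measurable function of $r$ and of all earlier answers, a batch of $K\ge1$ points $x^{(i)}_1,\dots,x^{(i)}_K\in\mathbb R^d$, and receives the answers $\big(F(x^{(i)}_k),g(x^{(i)}_k,\xi^{(i)})\big)_{k\le K}$, where $\xi^{(1)},\xi^{(2)},\dots$ are i.i.d. with law $\mathbb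 P_\xi$ and independent of $r$. It is zero-respecting if, for every $F\in C^1(\mathbb R^d,\mathbb R)$ and every unbiased stochastic gradient oracle of $F$, almost surely for every $i$ each coordinate in which some point of the batch $x^{(i)}$ is nonzero is a coordinate in which some stochastic gradient received in rounds $1,\dots,i-1$ is nonzero; $\mathcal A_{\mathrm{zr}}(d,K)$ denotes the set of these algorithms. Let $T_\varepsilon(A,F,O)\in\{1,2,\dots\}\cup\{\infty\}$ be the first round $T$ such that $\mathbb E\|\nabla F(x^{(T)}_k)\|\le\varepsilon$ for some $k\le K$, when $A$ is run against the oracle $O$ of $F$, and let $$\mathfrak m^{\mathrm{zr}}_\varepsilon(K,L_1,\Delta,\delta,\sigma_1^p)=\sup_{d\ge1}\ \sup_{F\in\mathcal F_d(\Delta,L_1)}\ \sup_{O\in\mathcal O(F)}\ \inf_{A\in\mathcal A_{\mathrm{zr}}(d,K)}T_\varepsilon(A,F,O).$$ **Theorem.** There is a universal constant $c_1>0$ such that for all $p\in(1,2]$ and $q\in[1,2]$ there is a constant $C>0$, depending only on $p$ and $q$, with the following property. For all $K\ge1$, $\Delta,L_1,\delta>0$, $\sigma_1\ge0$ and $0<\varepsilon\le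 c_1\sqrt{L_1\Delta}$, put $$R=\min\left\{\frac{L_1\Delta}{\varepsilon^2}+\frac{L_1\Delta}{\varepsilon^2}\Big(\frac{\sigma_1}{\varepsilon}\Big)^{\frac p{p-1}},\ \Big(\frac{\sigma_1}{\varepsilon}\Big)^{\frac p{p-1}}+\frac{(L_1+\delta)\Delta}{\varepsilon^2}+\frac{\delta\Delta}{\varepsilon^2}\Big(\frac{\sigma_1}{\varepsilon}\Big)^{\frac p{q(p-1)}}\right\}.$$ Then there are $d\ge1$, $F\in\mathcal F_d(\Delta,L_1)$ and $O\in\mathcal O(F)$ such that $T_\varepsilon(A,F,O)\ge C\,R$ for every $A\in\mathcal A_{\mathrm{zr}}(d,K)$; and, consequently, $\mathfrak m^{\mathrm{zr}}_\varepsilon(K,L_1,\Delta,\delta,\sigma_1^p)\ge C\,R$. -/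

import Mathlib

open MeasureTheory
open scoped ENNReal

universe u

noncomputable section

/-- The space `ℝ^d` with its Euclidean norm. -/
abbrev Vec (d : ℕ) : Type := EuclideanSpace ℝ (Fin d)

/-- The set of indices of the nonzero coordinates of a vector. -/
def vecSupport {d : ℕ} (x : Vec d) : Set (Fin d) := {c | x c ≠ 0}

/-- The class of continuously differentiable functions that are bounded below, have initial
suboptimality at most `Δ` at the origin, and have an `L₁`-Lipschitz gradient. -/
def FunctionClass (d : ℕ) (Δ L₁ : ℝ) : Set (Vec d → ℝ) :=
  {F | ContDiff ℝ 1 F ∧ BddBelow (Set.range F) ∧ F 0 - ⨅ x, F x ≤ Δ ∧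
    ∀ x y, ‖gradient F x - gradient F y‖ ≤ L₁ * ‖x - y‖}

/-- A stochastic first-order oracle for `F`: a probability distribution on a measurable space,
together with a (jointly measurable) unbiased estimator of the gradient of `F`. -/
structure StochasticOracle {d : ℕ} (F : Vec d → ℝ) where
  Sample : Type
  [measurableSpaceSample : MeasurableSpace Sample]
  law : Measure Sample
  [isProbabilityMeasure_law : IsProbabilityMeasure law]
  grad : Vec d → Sample → Vec d
  measurable_grad : Measurable (fun z : Vec d × Sample => grad z.1 z.2)
  integrable_grad : ∀ x, Integrable (grad x) law
  unbiased : ∀ x, ∫ ξ, grad x ξ ∂law = gradient F x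

attribute [instance] StochasticOracle.measurableSpaceSample
attribute [instance] StochasticOracle.isProbabilityMeasure_law

/-- The `p`-th central moment of the stochastic gradient is at most `σ₁ ^ p` at every point. -/
def StochasticOracle.BoundedCentralMoment {d : ℕ} {F : Vec d → ℝ} (O : StochasticOracle F)
    (p σ₁ : ℝ) : Prop :=
  ∀ x, ∫⁻ ξ, ‖O.grad x ξ - gradient F x‖ₑ ^ p ∂O.law ≤ ENNReal.ofReal (σ₁ ^ p)

/-- `(q, δ)`-similarity of the stochastic gradient and the gradient. -/
def StochasticOracle.Similarity {d : ℕ} {F : Vec d → ℝ} (O : StochasticOracle F)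
    (q δ : ℝ) : Prop :=
  ∀ x y, ∫⁻ ξ, ‖(O.grad x ξ - O.grad y ξ) - (gradient F x - gradient F y)‖ₑ ^ q ∂O.law
    ≤ ENNReal.ofReal (δ ^ q * ‖x - y‖ ^ q)

/-- The class of stochastic first-order oracles for `F` with `p`-th central moment at most
`σ₁ ^ p` and `(q, δ)`-similarity. -/
def OracleClass {d : ℕ} (F : Vec d → ℝ) (p σ₁ q δ : ℝ) : Set (StochasticOracle F) :=
  {O | O.BoundedCentralMoment p σ₁ ∧ O.Similarity q δ}

/-- A batch of `K` query points. -/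
abbrev Batch (d K : ℕ) : Type := Fin K → Vec d

/-- The answer to a batch: a function value and a stochastic gradient for each point. -/
abbrev Response (d K : ℕ) : Type := Fin K → ℝ × Vec d

/-- The answer of the oracle to a batch; the same sample `ξ` is used for all points of it. -/
def StochasticOracle.respond {d K : ℕ} {F : Vec d → ℝ} (O : StochasticOracle F)
    (x : Batch d K) (ξ : O.Sample) : Response d K :=
  fun k => (F (x k), O.grad (x k) ξ)

/-- A randomized algorithm that issues `K` queries per round: a random seed, drawn once, and for
each `i` a measurable map that produces the next batch from the `i` previous answers and the
seed. -/
structure RandomizedAlgorithm (d K : ℕ) where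
  Seed : Type u
  [measurableSpaceSeed : MeasurableSpace Seed]
  seedLaw : Measure Seed
  [isProbabilityMeasure_seedLaw : IsProbabilityMeasure seedLaw]
  next : (i : ℕ) → (Fin i → Response d K) → Seed → Batch d K
  measurable_next : ∀ i, Measurable
    (fun z : (Fin i → Response d K) × Seed => next i z.1 z.2)

attribute [instance] RandomizedAlgorithm.measurableSpaceSeed
attribute [instance] RandomizedAlgorithm.isProbabilityMeasure_seedLaw

namespace RandomizedAlgorithm

variable {d K : ℕ} {F : Vec d → ℝ}

/-- The batches issued by the algorithm against the oracle, given the seed `r` and the samples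
`ξ 0, ξ 1, …` of the successive rounds. Rounds are numbered from `0`: `A.query O r ξ i` is the
batch that the algorithm issues after it has received `i` answers. -/
def query (A : RandomizedAlgorithm.{u} d K) (O : StochasticOracle F) (r : A.Seed)
    (ξ : ℕ → O.Sample) (i : ℕ) : Batch d K :=
  A.next i (fun j : Fin i => O.respond (A.query O r ξ j) (ξ j)) r
termination_by i
decreasing_by exact j.2

/-- The joint law of the seed and of the samples of all rounds, which are independent. -/
def runLaw (A : RandomizedAlgorithm.{u} d K) (O : StochasticOracle F) :
    Measure (A.Seed × (ℕ → O.Sample)) :=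
  A.seedLaw.prod (Measure.infinitePi fun _ : ℕ => O.law)

/-- An algorithm is zero-respecting if, against every oracle of every continuously differentiable
function, almost surely the support of each batch is contained in the union of the supports of
the stochastic gradients received before. -/
def ZeroRespecting (A : RandomizedAlgorithm.{u} d K) : Prop :=
  ∀ F : Vec d → ℝ, ContDiff ℝ 1 F → ∀ O : StochasticOracle F,
    ∀ᵐ ω ∂(A.runLaw O), ∀ i : ℕ,
      (⋃ k : Fin K, vecSupport (A.query O ω.1 ω.2 i k)) ⊆
        ⋃ j : Fin i, ⋃ k : Fin K,
          vecSupport (O.respond (A.query O ω.1 ω.2 j) (ω.2 j) k).2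

/-- The first round `T ≥ 1` whose batch contains a point `x` with `𝔼 ‖∇F(x)‖ ≤ ε`
(`∞` if there is no such round). -/
def complexity (A : RandomizedAlgorithm.{u} d K) (O : StochasticOracle F) (ε : ℝ) : ℝ≥0∞ :=
  ⨅ (i : ℕ) (_ : ∃ k : Fin K,
      ∫⁻ ω, ‖gradient F (A.query O ω.1 ω.2 i k)‖ₑ ∂(A.runLaw O) ≤ ENNReal.ofReal ε),
    ((i + 1 : ℕ) : ℝ≥0∞)

end RandomizedAlgorithm

/-- The class of zero-respecting algorithms with `K` queries per round. -/
def ZeroRespectingClass (d K : ℕ) : Set (RandomizedAlgorithm.{u} d K) :=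
  {A | A.ZeroRespecting}

/-- The complexity of finding an `ε`-stationary point with zero-respecting algorithms: the
supremum, over the dimension, the function class and the oracle class, of the infimum, over the
zero-respecting algorithms, of the number of rounds. -/
def zeroRespectingComplexity (K : ℕ) (p q ε L₁ Δ δ σ₁ : ℝ) : ℝ≥0∞ :=
  ⨆ (d : ℕ) (_ : 1 ≤ d) (F ∈ FunctionClass d Δ L₁) (O ∈ OracleClass F p σ₁ q δ),
    ⨅ A ∈ ZeroRespectingClass.{u} d K, A.complexity O ε

/-- The minimum of the two rates in the lower bound. -/
def lowerRate (p q ε L₁ Δ δ σ₁ : ℝ) : ℝ :=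
  min (L₁ * Δ / ε ^ 2 + L₁ * Δ / ε ^ 2 * (σ₁ / ε) ^ (p / (p - 1)))
    ((σ₁ / ε) ^ (p / (p - 1)) + (L₁ + δ) * Δ / ε ^ 2 +
      δ * Δ / ε ^ 2 * (σ₁ / ε) ^ (p / (q * (p - 1))))

end

/-!
The hard function is a zero-chain: a point that involves only the first `m` coordinates has a
gradient that involves only the first `m + 1`, and until all `d` coordinates are involved this
gradient has norm at least `2 ε`. The oracle multiplies the part of the gradient that reveals the
next coordinate by `ξ / θ` with `ξ` a Bernoulli variable of mean `θ`. A zero-respecting algorithm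
thus learns at most one coordinate per round, and only in rounds with `ξ = 1`, whatever the batch
size; by Markov's inequality it still lacks one with probability at least `1 / 2` after
`d / (2 θ)` rounds. The noise has `p`-th moment of order `ε ^ p θ ^ (1 - p)` and, for a chain with
`L`-Lipschitz gradient, mean smoothness of order `L θ ^ ((1 - q) / q)`. The rate is the best of
three instances: a noiseless chain, a masked single coordinate, and a masked chain with
`L = min L₁ (δ θ ^ ((q - 1) / q))`.
-/

noncomputable section

section Flag

variable {d : ℕ}

/-- The `m`-th step of the standard flag of `ℝ^d`: the vectors whose coordinates from index `m` on
vanish, that is, the points in reach of a zero-respecting algorithm to which the coordinates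
`0, …, m - 1` have been revealed. -/
def stdFlag (d m : ℕ) : Submodule ℝ (Vec d) where
  carrier := {x | ∀ i : Fin d, m ≤ i → x i = 0}
  add_mem' hx hy i hi := by rw [PiLp.add_apply, hx i hi, hy i hi, add_zero]
  zero_mem' _ _ := rfl
  smul_mem' a x hx i hi := by rw [PiLp.smul_apply, hx i hi, smul_zero]

theorem stdFlag_mono : Monotone (stdFlag d) :=
  fun _ _ hmn _ hx i hi => hx i (hmn.trans hi)

/-- A vector field on `ℝ^d` reveals at most `k` coordinates if it increases by at most `k` the
number of initial coordinates that a point involves. For `k = 1` this is the zero-chain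
property. -/
def RevealsAtMost (G : Vec d → Vec d) (k : ℕ) : Prop :=
  ∀ ⦃x : Vec d⦄ ⦃m : ℕ⦄, x ∈ stdFlag d m → G x ∈ stdFlag d (m + k)

namespace RevealsAtMost

variable {G : Vec d → Vec d} {k : ℕ}

theorem smul_comp_smul (hG : RevealsAtMost G k) (a c : ℝ) :
    RevealsAtMost (fun x => a • G (c • x)) k :=
  fun _ _ hx => Submodule.smul_mem _ a (hG (Submodule.smul_mem _ c hx))

end RevealsAtMost

end Flag

section Progress

/-- The number of coordinates that the samples of the first `i` rounds can reveal, when a sample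
`ξ` reveals at most `w ξ` of them. -/
def revealedCount {Ω : Type*} (w : Ω → ℕ) (ξ : ℕ → Ω) (i : ℕ) : ℕ :=
  ∑ l ∈ Finset.range i, w (ξ l)

@[fun_prop]
theorem measurable_revealedCount {Ω : Type*} [MeasurableSpace Ω] {w : Ω → ℕ} (hw : Measurable w)
    (i : ℕ) : Measurable fun ξ => revealedCount w ξ i := by
  unfold revealedCount
  fun_prop

namespace RandomizedAlgorithm

variable {d K : ℕ} {F : Vec d → ℝ} {O : StochasticOracle F} {w : O.Sample → ℕ}

theorem query_mem_stdFlag {A : RandomizedAlgorithm.{u} d K}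
    (hO : ∀ ξ, RevealsAtMost (O.grad · ξ) (w ξ)) {r : A.Seed} {ξ : ℕ → O.Sample}
    (hzr : ∀ i : ℕ, (⋃ k : Fin K, vecSupport (A.query O r ξ i k)) ⊆
        ⋃ j : Fin i, ⋃ k : Fin K, vecSupport (O.respond (A.query O r ξ j) (ξ j) k).2)
    (i : ℕ) (k : Fin K) : A.query O r ξ i k ∈ stdFlag d (revealedCount w ξ i) := by
  induction i using Nat.strong_induction_on generalizing k with
  | _ i ih =>
    intro c hc
    by_contra hne
    obtain ⟨j, hj⟩ := Set.mem_iUnion.1 (hzr i (Set.mem_iUnion.2 ⟨k, hne⟩))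
    obtain ⟨k', hk'⟩ := Set.mem_iUnion.1 hj
    have hgrad : O.grad (A.query O r ξ j k') (ξ j) ∈ stdFlag d (revealedCount w ξ (j + 1)) := by
      rw [revealedCount, Finset.sum_range_succ]
      exact hO (ξ j) (ih j j.2 k')
    exact hk' (stdFlag_mono (Finset.sum_le_sum_of_subset (Finset.range_mono j.2)) hgrad c hc)

instance isProbabilityMeasure_runLaw (A : RandomizedAlgorithm.{u} d K) :
    IsProbabilityMeasure (A.runLaw O) := by
  unfold runLaw
  infer_instance

theorem lintegral_revealedCount (A : RandomizedAlgorithm.{u} d K) (hw : Measurable w) (i : ℕ) :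
    ∫⁻ ω, (revealedCount w ω.2 i : ℝ≥0∞) ∂(A.runLaw O) = i * ∫⁻ ξ, (w ξ : ℝ≥0∞) ∂O.law := by
  have hsample (l : ℕ) :
      ∫⁻ ω, (w (ω.2 l) : ℝ≥0∞) ∂(A.runLaw O) = ∫⁻ ξ, (w ξ : ℝ≥0∞) ∂O.law := by
    have hpres : MeasurePreserving (fun ω : A.Seed × (ℕ → O.Sample) => ω.2 l)
        (A.runLaw O) O.law :=
      (measurePreserving_eval_infinitePi (fun _ : ℕ => O.law) l).comp measurePreserving_snd
    exact hpres.lintegral_comp (f := fun ξ => (w ξ : ℝ≥0∞)) (by fun_prop)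
  simp only [revealedCount, Nat.cast_sum]
  rw [lintegral_finsetSum _ fun l _ => by fun_prop]
  simp [hsample]

theorem runLaw_real_le_revealedCount_le (A : RandomizedAlgorithm.{u} d K) (hw : Measurable w)
    {θ : ℝ} (hθ : 0 ≤ θ) (hmean : ∫⁻ ξ, (w ξ : ℝ≥0∞) ∂O.law ≤ ENNReal.ofReal θ) (i : ℕ) {m : ℕ}
    (hm : 0 < m) :
    (A.runLaw O).real {ω | m ≤ revealedCount w ω.2 i} ≤ i * θ / m := by
  have hmarkov : m * A.runLaw O {ω | m ≤ revealedCount w ω.2 i} ≤ ENNReal.ofReal (i * θ) := by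
    calc m * A.runLaw O {ω | m ≤ revealedCount w ω.2 i}
        ≤ ∫⁻ ω, (revealedCount w ω.2 i : ℝ≥0∞) ∂(A.runLaw O) := by
          have hmeas : Measurable fun ω : A.Seed × (ℕ → O.Sample) =>
              (revealedCount w ω.2 i : ℝ≥0∞) := by fun_prop
          simpa only [Nat.cast_le] using mul_meas_ge_le_lintegral hmeas m
      _ ≤ ENNReal.ofReal (i * θ) := by
          rw [A.lintegral_revealedCount hw, ENNReal.ofReal_mul (by positivity),
            ENNReal.ofReal_natCast]
          gcongr
  rw [le_div_iff₀' (by positivity), measureReal_def, ← ENNReal.toReal_natCast m,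
    ← ENNReal.toReal_mul]
  exact ENNReal.toReal_le_of_le_ofReal (by positivity) hmarkov

theorem mul_runLaw_le_lintegral_gradient (hF : ContDiff ℝ 1 F) (hw : Measurable w)
    (hO : ∀ ξ, RevealsAtMost (O.grad · ξ) (w ξ)) {m : ℕ} {c : ℝ}
    (hgrad : ∀ n < m, ∀ x ∈ stdFlag d n, c ≤ ‖gradient F x‖)
    {A : RandomizedAlgorithm.{u} d K} (hA : A.ZeroRespecting) (i : ℕ) (k : Fin K) :
    ENNReal.ofReal c * A.runLaw O {ω | m ≤ revealedCount w ω.2 i}ᶜ ≤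
      ∫⁻ ω, ‖gradient F (A.query O ω.1 ω.2 i k)‖ₑ ∂(A.runLaw O) := by
  have hmeas : MeasurableSet {ω : A.Seed × (ℕ → O.Sample) | m ≤ revealedCount w ω.2 i} :=
    measurableSet_le measurable_const (by fun_prop)
  rw [← lintegral_indicator_const hmeas.compl]
  refine lintegral_mono_ae ?_
  filter_upwards [hA F hF O] with ω hzr
  refine Set.indicator_apply_le' (fun hω => ?_) fun _ => zero_le
  rw [← ofReal_norm]
  exact ENNReal.ofReal_le_ofReal (hgrad _ (not_le.1 hω) _ (query_mem_stdFlag hO hzr i k))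

theorem ofReal_div_le_complexity (hF : ContDiff ℝ 1 F) (hw : Measurable w)
    (hO : ∀ ξ, RevealsAtMost (O.grad · ξ) (w ξ)) {θ ε : ℝ} (hθ : 0 < θ) (hε : 0 < ε)
    (hmean : ∫⁻ ξ, (w ξ : ℝ≥0∞) ∂O.law ≤ ENNReal.ofReal θ) {m : ℕ}
    (hgrad : ∀ n < m, ∀ x ∈ stdFlag d n, 2 * ε ≤ ‖gradient F x‖)
    {A : RandomizedAlgorithm.{u} d K} (hA : A.ZeroRespecting) :
    ENNReal.ofReal (m / (2 * θ)) ≤ A.complexity O ε := by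
  refine le_iInf₂ fun i ⟨k, hk⟩ => ?_
  by_contra! hlt
  have hiθ : i * θ < m / 2 := by
    rw [← ENNReal.ofReal_natCast, ENNReal.ofReal_lt_ofReal_iff_of_nonneg (by positivity),
      lt_div_iff₀ (by positivity)] at hlt
    push_cast at hlt
    linarith
  have hm : 0 < m := by
    have : 0 ≤ i * θ := by positivity
    exact_mod_cast (by linarith : (0 : ℝ) < m)
  have hmeas : MeasurableSet {ω : A.Seed × (ℕ → O.Sample) | m ≤ revealedCount w ω.2 i} :=
    measurableSet_le measurable_const (by fun_prop)
  have hhalf : 1 / 2 < (A.runLaw O).real {ω | m ≤ revealedCount w ω.2 i}ᶜ := by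
    have hbad := A.runLaw_real_le_revealedCount_le hw hθ.le hmean i hm
    have : i * θ / m < 1 / 2 := by
      rw [div_lt_iff₀ (by positivity)]
      linarith
    rw [probReal_compl_eq_one_sub hmeas]
    linarith
  have hsmall := ENNReal.toReal_le_of_le_ofReal hε.le
    ((mul_runLaw_le_lintegral_gradient hF hw hO hgrad hA i k).trans hk)
  rw [ENNReal.toReal_mul, ENNReal.toReal_ofReal (by positivity), ← measureReal_def] at hsmall
  nlinarith

end RandomizedAlgorithm

end Progress

section BernoulliNoise

open ProbabilityTheory unitInterval

/-- The centred noise factor `ξ / θ - 1`, where `ξ` is a Bernoulli variable with success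
probability `θ`. -/
def noiseFactor (θ : ℝ) : Bool → ℝ
  | true => θ⁻¹ - 1
  | false => -1

theorem lintegral_bernoulliMeasure_bool (θ : I) (f : Bool → ℝ≥0∞) :
    ∫⁻ b, f b ∂(bernoulliMeasure true false θ) =
      ENNReal.ofReal θ * f true + ENNReal.ofReal (1 - θ) * f false := by
  have hcoe (t : I) : ((toNNReal t : NNReal) : ℝ≥0∞) = ENNReal.ofReal t :=
    (ENNReal.ofReal_eq_coe_nnreal t.2.1).symm
  simp [bernoulliMeasure_def, lintegral_add_measure, hcoe, ENNReal.smul_def]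

variable {θ : I}

theorem lintegral_enorm_noiseFactor_rpow_le (hθ : 0 < (θ : ℝ)) {r : ℝ} (hr : 1 ≤ r) :
    ∫⁻ b, ‖noiseFactor θ b‖ₑ ^ r ∂(bernoulliMeasure true false θ) ≤
      ENNReal.ofReal (2 * θ ^ (1 - r)) := by
  have hr0 : 0 ≤ r := zero_le_one.trans hr
  have hθ1 : (θ : ℝ) ≤ 1 := θ.2.2
  have hinv : 1 ≤ (θ : ℝ)⁻¹ := (one_le_inv₀ hθ).2 hθ1
  have henorm (t : ℝ) : ‖t‖ₑ ^ r = ENNReal.ofReal (|t| ^ r) := by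
    rw [Real.enorm_eq_ofReal_abs, ENNReal.ofReal_rpow_of_nonneg (abs_nonneg t) hr0]
  have htrue : θ * |(θ : ℝ)⁻¹ - 1| ^ r ≤ (θ : ℝ) ^ (1 - r) := by
    calc θ * |(θ : ℝ)⁻¹ - 1| ^ r ≤ θ * (θ : ℝ)⁻¹ ^ r := by
          gcongr
          rw [abs_of_nonneg (by linarith)]
          linarith
      _ = (θ : ℝ) ^ (1 - r) := by
          rw [Real.inv_rpow hθ.le, Real.rpow_sub hθ, Real.rpow_one, div_eq_mul_inv]
  have hfalse : 1 - θ ≤ (θ : ℝ) ^ (1 - r) := by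
    have : 1 ≤ (θ : ℝ) ^ (1 - r) :=
      Real.one_le_rpow_of_pos_of_le_one_of_nonpos hθ hθ1 (by linarith)
    linarith
  rw [lintegral_bernoulliMeasure_bool]
  simp only [henorm, noiseFactor, abs_neg, abs_one, Real.one_rpow, ENNReal.ofReal_one, mul_one]
  rw [← ENNReal.ofReal_mul hθ.le, ← ENNReal.ofReal_add (by positivity) (by linarith)]
  exact ENNReal.ofReal_le_ofReal (by linarith)

theorem lintegral_enorm_noiseFactor_smul_rpow_le {E : Type*} [NormedAddCommGroup E]
    [NormedSpace ℝ E] (hθ : 0 < (θ : ℝ)) {r c : ℝ} (hr : 1 ≤ r) {v : E} (hv : ‖v‖ ≤ c) :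
    ∫⁻ b, ‖noiseFactor θ b • v‖ₑ ^ r ∂(bernoulliMeasure true false θ) ≤
      ENNReal.ofReal (2 * c ^ r * θ ^ (1 - r)) := by
  have hr0 : 0 ≤ r := zero_le_one.trans hr
  calc ∫⁻ b, ‖noiseFactor θ b • v‖ₑ ^ r ∂(bernoulliMeasure true false θ)
      = (∫⁻ b, ‖noiseFactor θ b‖ₑ ^ r ∂(bernoulliMeasure true false θ)) * ‖v‖ₑ ^ r := by
        simp only [enorm_smul, ENNReal.mul_rpow_of_nonneg _ _ hr0]
        exact lintegral_mul_const _ .of_discrete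
    _ ≤ ENNReal.ofReal (2 * θ ^ (1 - r)) * ENNReal.ofReal (c ^ r) := by
        rw [← ENNReal.ofReal_rpow_of_nonneg ((norm_nonneg v).trans hv) hr0, ← ofReal_norm]
        gcongr
        exact lintegral_enorm_noiseFactor_rpow_le hθ hr
    _ = ENNReal.ofReal (2 * c ^ r * θ ^ (1 - r)) := by
        rw [← ENNReal.ofReal_mul (by positivity)]
        congr 1
        ring

theorem lintegral_toNat_bernoulliMeasure (θ : I) :
    ∫⁻ b, (b.toNat : ℝ≥0∞) ∂(bernoulliMeasure true false θ) = ENNReal.ofReal θ := by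
  simp [lintegral_bernoulliMeasure_bool]

theorem revealsAtMost_add_noiseFactor_smul {d : ℕ} {G N : Vec d → Vec d} {θ : ℝ}
    (hG : RevealsAtMost G 1) (hmask : RevealsAtMost (fun x => G x - N x) 0) :
    ∀ b, RevealsAtMost (fun x => G x + noiseFactor θ b • N x) b.toNat
  | false => by
    simpa only [noiseFactor, neg_smul, one_smul, ← sub_eq_add_neg, Bool.toNat_false] using hmask
  | true => fun x m hx => by
    have hsplit : G x + noiseFactor θ true • N x = θ⁻¹ • G x - (θ⁻¹ - 1) • (G x - N x) := by
      simp only [noiseFactor]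
      module
    simp only [hsplit]
    exact sub_mem (Submodule.smul_mem _ _ (hG hx))
      (Submodule.smul_mem _ _ (stdFlag_mono m.le_succ (hmask hx)))

end BernoulliNoise

namespace StochasticOracle

open ProbabilityTheory unitInterval

variable {d : ℕ} {F : Vec d → ℝ}

/-- The oracle that answers with the gradient itself. -/
def exact (hF : Continuous (gradient F)) : StochasticOracle F where
  Sample := Unit
  law := Measure.dirac ()
  grad x _ := gradient F x
  measurable_grad := hF.measurable.comp measurable_fst
  integrable_grad _ := integrable_const _
  unbiased _ := by simp

theorem exact_mem_oracleClass (hF : Continuous (gradient F)) {p q : ℝ} (hp : 0 < p) (hq : 0 < q)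
    (σ₁ δ : ℝ) : exact hF ∈ OracleClass F p σ₁ q δ := by
  constructor
  · intro x
    calc _ = ∫⁻ _, 0 ∂(exact hF).law := lintegral_congr fun _ => by simp [exact, hp]
      _ ≤ _ := by simp only [lintegral_zero, zero_le]
  · intro x y
    calc _ = ∫⁻ _, 0 ∂(exact hF).law := lintegral_congr fun _ => by simp [exact, hq]
      _ ≤ _ := by simp only [lintegral_zero, zero_le]

theorem ofReal_half_le_complexity_exact (hF : ContDiff ℝ 1 F) (hF' : Continuous (gradient F))
    {ε : ℝ} (hε : 0 < ε) (hreveal : RevealsAtMost (gradient F) 1) {m : ℕ}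
    (hgrad : ∀ n < m, ∀ x ∈ stdFlag d n, 2 * ε ≤ ‖gradient F x‖) {K : ℕ}
    {A : RandomizedAlgorithm.{u} d K} (hA : A.ZeroRespecting) :
    ENNReal.ofReal (m / 2) ≤ A.complexity (exact hF') ε := by
  simpa only [mul_one] using RandomizedAlgorithm.ofReal_div_le_complexity (w := fun _ => 1) hF
    measurable_const (O := exact hF') (fun _ => hreveal) one_pos hε (by simp) hgrad hA

/-- The oracle that perturbs the gradient by a vector field `N` times the centred noise factor. A
failing Bernoulli trial, whose answer is `∇F - N`, conceals whatever `N` cancels. -/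
def bernoulli (hF : Continuous (gradient F)) {N : Vec d → Vec d} (hN : Continuous N) {θ : I}
    (hθ : 0 < (θ : ℝ)) : StochasticOracle F where
  Sample := Bool
  law := bernoulliMeasure true false θ
  grad x b := gradient F x + noiseFactor θ b • N x
  measurable_grad := measurable_from_prod_countable_left fun b =>
    (hF.add (hN.const_smul (noiseFactor θ b))).measurable
  integrable_grad _ := .of_finite
  unbiased x := by
    have hcentred : θ * noiseFactor θ true + (1 - θ) * noiseFactor θ false = 0 := by
      simp only [noiseFactor]
      field_simp
      ring
    rw [integral_bernoulliMeasure]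
    calc _ = gradient F x + (θ * noiseFactor θ true + (1 - θ) * noiseFactor θ false) • N x := by
          module
      _ = gradient F x := by rw [hcentred, zero_smul, add_zero]

variable {N : Vec d → Vec d} {θ : I}

theorem bernoulli_mem_oracleClass (hF : Continuous (gradient F)) (hN : Continuous N)
    (hθ : 0 < (θ : ℝ)) {p q σ₁ δ c ℓ : ℝ} (hp : 1 ≤ p) (hq : 1 ≤ q) (hℓ : 0 ≤ ℓ)
    (hbound : ∀ x, ‖N x‖ ≤ c) (hlip : ∀ x y, ‖N x - N y‖ ≤ ℓ * ‖x - y‖)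
    (hσ : 2 * c ^ p * θ ^ (1 - p) ≤ σ₁ ^ p) (hδ : 2 * ℓ ^ q * θ ^ (1 - q) ≤ δ ^ q) :
    bernoulli hF hN hθ ∈ OracleClass F p σ₁ q δ := by
  constructor
  · intro x
    simp only [bernoulli, add_sub_cancel_left]
    exact (lintegral_enorm_noiseFactor_smul_rpow_le hθ hp (hbound x)).trans
      (ENNReal.ofReal_le_ofReal hσ)
  · intro x y
    simp only [bernoulli, add_sub_add_comm, add_sub_cancel_left, ← smul_sub]
    refine (lintegral_enorm_noiseFactor_smul_rpow_le hθ hq (hlip x y)).trans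
      (ENNReal.ofReal_le_ofReal ?_)
    rw [Real.mul_rpow hℓ (norm_nonneg _)]
    calc _ = (2 * ℓ ^ q * θ ^ (1 - q)) * ‖x - y‖ ^ q := by ring
      _ ≤ _ := by gcongr

theorem ofReal_div_le_complexity_bernoulli (hF : ContDiff ℝ 1 F) (hF' : Continuous (gradient F))
    (hN : Continuous N) (hθ : 0 < (θ : ℝ)) {ε : ℝ} (hε : 0 < ε)
    (hreveal : RevealsAtMost (gradient F) 1)
    (hmask : RevealsAtMost (fun x => gradient F x - N x) 0) {m : ℕ}
    (hgrad : ∀ n < m, ∀ x ∈ stdFlag d n, 2 * ε ≤ ‖gradient F x‖) {K : ℕ}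
    {A : RandomizedAlgorithm.{u} d K} (hA : A.ZeroRespecting) :
    ENNReal.ofReal (m / (2 * θ)) ≤ A.complexity (bernoulli hF' hN hθ) ε :=
  RandomizedAlgorithm.ofReal_div_le_complexity (w := Bool.toNat) hF
    (Measurable.of_discrete (α := Bool))
    (revealsAtMost_add_noiseFactor_smul hreveal hmask) hθ hε (lintegral_toNat_bernoulliMeasure θ).le
    hgrad hA

end StochasticOracle

section RampStep

/-- The quadratic ramp `max(t, 0)² / 2`, a `C¹` primitive of the positive part. -/
def sqRamp (t : ℝ) : ℝ := max t 0 ^ 2 / 2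

theorem sqRamp_of_nonneg {t : ℝ} (ht : 0 ≤ t) : sqRamp t = t ^ 2 / 2 := by
  rw [sqRamp, max_eq_left ht]

theorem sqRamp_of_nonpos {t : ℝ} (ht : t ≤ 0) : sqRamp t = 0 := by simp [sqRamp, ht]

theorem sqRamp_nonneg (t : ℝ) : 0 ≤ sqRamp t := by
  unfold sqRamp
  positivity

theorem hasDerivAt_sqRamp (t : ℝ) : HasDerivAt sqRamp (max t 0) t := by
  have hsq : HasDerivAt (fun t : ℝ => t ^ 2 / 2) t t := by
    simpa using ((hasDerivAt_id t).pow 2).div_const 2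
  have hleft (ht : t ≤ 0) : HasDerivWithinAt sqRamp 0 (Set.Iic 0) t :=
    (hasDerivWithinAt_const t _ 0).congr (fun s hs => sqRamp_of_nonpos hs) (sqRamp_of_nonpos ht)
  have hright (ht : 0 ≤ t) : HasDerivWithinAt sqRamp t (Set.Ici 0) t :=
    hsq.hasDerivWithinAt.congr (fun s hs => sqRamp_of_nonneg hs) (sqRamp_of_nonneg ht)
  rcases lt_trichotomy t 0 with ht | rfl | ht
  · rw [max_eq_right ht.le]
    exact (hleft ht.le).hasDerivAt (Iic_mem_nhds ht)
  · rw [max_self]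
    simpa using (hleft le_rfl).union (hright le_rfl)
  · rw [max_eq_left ht.le]
    exact (hright ht.le).hasDerivAt (Ici_mem_nhds ht)

@[fun_prop]
theorem contDiff_sqRamp : ContDiff ℝ 1 sqRamp := by
  rw [contDiff_one_iff_deriv]
  refine ⟨fun t => (hasDerivAt_sqRamp t).differentiableAt, ?_⟩
  rw [show deriv sqRamp = fun t => max t 0 from funext fun t => (hasDerivAt_sqRamp t).deriv]
  fun_prop

/-- For `a + 1 ≤ b`, a `C¹` step that rises from `0` on `(-∞, a]` to `b - a` on `[b + 1, ∞)`, with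
slope `1` on `[a + 1, b]`. -/
def rampStep (a b t : ℝ) : ℝ :=
  sqRamp (t - a) - sqRamp (t - (a + 1)) - sqRamp (t - b) + sqRamp (t - (b + 1))

/-- For `a + 1 ≤ b`, the derivative of `rampStep a b`: a trapezoid over `[a, b + 1]`. -/
def trapezoid (a b t : ℝ) : ℝ := max 0 (min 1 (min (t - a) (b + 1 - t)))

variable {a b : ℝ}

theorem trapezoid_nonneg (a b t : ℝ) : 0 ≤ trapezoid a b t := le_max_left _ _

theorem trapezoid_le_one (a b t : ℝ) : trapezoid a b t ≤ 1 :=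
  max_le zero_le_one (min_le_left _ _)

theorem trapezoid_of_le {t : ℝ} (ht : t ≤ a) : trapezoid a b t = 0 := by
  unfold trapezoid
  grind

theorem trapezoid_of_mem_Icc {t : ℝ} (ht : t ∈ Set.Icc (a + 1) b) : trapezoid a b t = 1 := by
  obtain ⟨hat, htb⟩ := ht
  unfold trapezoid
  grind

theorem abs_trapezoid_sub_le (a b t s : ℝ) : |trapezoid a b t - trapezoid a b s| ≤ |t - s| := by
  unfold trapezoid
  grind

theorem contDiff_rampStep (a b : ℝ) : ContDiff ℝ 1 (rampStep a b) := by
  unfold rampStep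
  fun_prop

theorem rampStep_of_le (hab : a + 1 ≤ b) {t : ℝ} (ht : t ≤ a) : rampStep a b t = 0 := by
  rw [rampStep, sqRamp_of_nonpos (by linarith), sqRamp_of_nonpos (by linarith),
    sqRamp_of_nonpos (by linarith), sqRamp_of_nonpos (by linarith)]
  ring

theorem rampStep_of_ge (hab : a + 1 ≤ b) {t : ℝ} (ht : b + 1 ≤ t) : rampStep a b t = b - a := by
  rw [rampStep, sqRamp_of_nonneg (by linarith), sqRamp_of_nonneg (by linarith),
    sqRamp_of_nonneg (by linarith), sqRamp_of_nonneg (by linarith)]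
  ring

theorem hasDerivAt_rampStep (hab : a + 1 ≤ b) (t : ℝ) :
    HasDerivAt (rampStep a b) (trapezoid a b t) t := by
  have hshift (c : ℝ) : HasDerivAt (fun t => sqRamp (t - c)) (max (t - c) 0) t :=
    (hasDerivAt_sqRamp (t - c)).comp_sub_const t c
  refine ((((hshift a).sub (hshift (a + 1))).sub (hshift b)).add (hshift (b + 1))).congr_deriv ?_
  unfold trapezoid
  grind

theorem rampStep_monotone (hab : a + 1 ≤ b) : Monotone (rampStep a b) :=
  monotone_of_hasDerivAt_nonneg (hasDerivAt_rampStep hab) (trapezoid_nonneg a b)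

theorem rampStep_nonneg (hab : a + 1 ≤ b) (t : ℝ) : 0 ≤ rampStep a b t :=
  (rampStep_of_le hab (min_le_right t a)).ge.trans (rampStep_monotone hab (min_le_left t a))

theorem rampStep_le (hab : a + 1 ≤ b) (t : ℝ) : rampStep a b t ≤ b - a :=
  (rampStep_monotone hab (le_max_left t (b + 1))).trans
    (rampStep_of_ge hab (le_max_right t (b + 1))).le

theorem abs_rampStep_sub_le (hab : a + 1 ≤ b) (t s : ℝ) :
    |rampStep a b t - rampStep a b s| ≤ |t - s| := by
  have hbound (u : ℝ) : ‖trapezoid a b u‖ ≤ 1 := by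
    rw [Real.norm_of_nonneg (trapezoid_nonneg a b u)]
    exact trapezoid_le_one a b u
  simpa using convex_univ.norm_image_sub_le_of_norm_hasDerivWithin_le
    (fun u _ => (hasDerivAt_rampStep hab u).hasDerivWithinAt) (fun u _ => hbound u)
    (Set.mem_univ s) (Set.mem_univ t)

theorem abs_mul_sub_mul_le (a b a' b' : ℝ) :
    |a * b - a' * b'| ≤ |a - a'| * |b| + |a'| * |b - b'| := by
  rw [← abs_mul, ← abs_mul, show a * b - a' * b' = (a - a') * b + a' * (b - b') by ring]
  exact abs_add_le _ _

end RampStep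

section Chain

variable {d : ℕ}

/-- The linear part of `node · n`: the coordinate with index `n - 1` if there is one, else `0`. -/
def nodeLinear (d : ℕ) : ℕ → (Vec d →L[ℝ] ℝ)
  | 0 => 0
  | n + 1 => if h : n < d then EuclideanSpace.proj ⟨n, h⟩ else 0

/-- The `n`-th node of the chain: `3` at `n = 0`, then the coordinates of `x`, then `0`. The shift
lets the first coordinate be treated like the others, with an already reached predecessor. -/
def node (x : Vec d) (n : ℕ) : ℝ := (if n = 0 then 3 else 0) + nodeLinear d n x

@[simp] theorem nodeLinear_zero : nodeLinear d 0 = 0 := rfl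

@[simp] theorem nodeLinear_succ (v : Vec d) (i : Fin d) : nodeLinear d (i + 1) v = v i := by
  simp [nodeLinear]

@[simp] theorem nodeLinear_add_one_self : nodeLinear d (d + 1) = 0 := by simp [nodeLinear]

@[simp] theorem node_zero (x : Vec d) : node x 0 = 3 := by simp [node]

@[simp] theorem node_succ (x : Vec d) (i : Fin d) : node x (i + 1) = x i := by simp [node]

theorem node_sub (x y : Vec d) (n : ℕ) : node x n - node y n = nodeLinear d n (x - y) := by
  simp [node, map_sub]

theorem node_eq_zero {x : Vec d} {m n : ℕ} (hx : x ∈ stdFlag d m) (hmn : m < n) :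
    node x n = 0 := by
  obtain ⟨n, rfl⟩ : ∃ k, n = k + 1 := ⟨n - 1, by omega⟩
  by_cases hn : n < d
  · exact (node_succ x ⟨n, hn⟩).trans (hx ⟨n, hn⟩ (Nat.lt_succ_iff.1 hmn))
  · simp [node, nodeLinear, hn]

theorem hasFDerivAt_node (x : Vec d) (n : ℕ) :
    HasFDerivAt (fun x : Vec d => node x n) (nodeLinear d n) x :=
  (nodeLinear d n).hasFDerivAt.const_add _

theorem contDiff_node (n : ℕ) : ContDiff ℝ 1 fun x : Vec d => node x n :=
  contDiff_const.add (nodeLinear d n).contDiff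

theorem sum_nodeLinear_sq_le (s : Finset ℕ) (v : Vec d) :
    ∑ n ∈ s, nodeLinear d n v ^ 2 ≤ ‖v‖ ^ 2 := by
  have hsupp : s.filter (fun n => nodeLinear d n v ^ 2 ≠ 0) ⊆
      Finset.univ.image fun i : Fin d => (i : ℕ) + 1 := by
    intro n hn
    obtain ⟨-, hne⟩ := Finset.mem_filter.1 hn
    rcases n with _ | n
    · simp at hne
    · by_cases h : n < d
      · exact Finset.mem_image.2 ⟨⟨n, h⟩, Finset.mem_univ _, rfl⟩
      · simp [nodeLinear, h] at hne
  calc ∑ n ∈ s, nodeLinear d n v ^ 2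
      = ∑ n ∈ s with nodeLinear d n v ^ 2 ≠ 0, nodeLinear d n v ^ 2 :=
        (Finset.sum_filter_ne_zero s).symm
    _ ≤ ∑ n ∈ Finset.univ.image fun i : Fin d => (i : ℕ) + 1, nodeLinear d n v ^ 2 :=
        Finset.sum_le_sum_of_subset_of_nonneg hsupp fun _ _ _ => sq_nonneg _
    _ = ∑ i : Fin d, v i ^ 2 := by
        rw [Finset.sum_image fun i _ j _ hij => Fin.ext (Nat.succ_injective hij)]
        simp
    _ = ‖v‖ ^ 2 := by simp [EuclideanSpace.norm_sq_eq]

theorem sum_nodeLinear_add_sq_le (k : ℕ) (v : Vec d) :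
    ∑ i : Fin d, nodeLinear d (i + k) v ^ 2 ≤ ‖v‖ ^ 2 := by
  rw [← Finset.sum_image (g := fun i : Fin d => (i : ℕ) + k) (f := fun n => nodeLinear d n v ^ 2)
    fun i _ j _ hij => Fin.ext (Nat.add_right_cancel hij)]
  exact sum_nodeLinear_sq_le _ v

/-- The coupling of two consecutive nodes: it rewards the second for growing only once the first
exceeds `1`. -/
def link (a b : ℝ) : ℝ := sqRamp (-b) - rampStep 1 2 a * rampStep (-1) 3 b

/-- The zero-chain: the sum of the links of all pairs of consecutive nodes. -/
def chain (d : ℕ) (x : Vec d) : ℝ := ∑ n ∈ Finset.range (d + 1), link (node x n) (node x (n + 1))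

/-- The partial derivative of `chain` in a node with value `b`, predecessor `a` and successor
`c`. -/
def chainPartial (a b c : ℝ) : ℝ :=
  min b 0 - rampStep 1 2 a * trapezoid (-1) 3 b - trapezoid 1 2 b * rampStep (-1) 3 c

/-- The gradient of `chain`. -/
def chainGrad (x : Vec d) : Vec d :=
  WithLp.toLp 2 fun i => chainPartial (node x i) (node x (i + 1)) (node x (i + 2))

theorem chainPartial_zero (a c : ℝ) : chainPartial a 0 c = -rampStep 1 2 a := by
  rw [chainPartial, trapezoid_of_le zero_le_one,
    trapezoid_of_mem_Icc ⟨by norm_num, by norm_num⟩]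
  simp

theorem chainPartial_le_neg_one {a b : ℝ} (ha : 3 ≤ a) (hb : b ≤ 3) (c : ℝ) :
    chainPartial a b c ≤ -1 := by
  have hmin : min b 0 - trapezoid (-1) 3 b ≤ -1 := by
    unfold trapezoid
    grind
  have hnext : 0 ≤ trapezoid 1 2 b * rampStep (-1) 3 c :=
    mul_nonneg (trapezoid_nonneg 1 2 b) (rampStep_nonneg (by norm_num) c)
  rw [chainPartial, rampStep_of_ge (by norm_num) (by linarith)]
  linarith

theorem abs_chainPartial_sub_le (a b c a' b' c' : ℝ) :
    |chainPartial a b c - chainPartial a' b' c'| ≤ |a - a'| + 6 * |b - b'| + |c - c'| := by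
  have hmin : |min b 0 - min b' 0| ≤ |b - b'| := by grind
  have hprev : |rampStep 1 2 a * trapezoid (-1) 3 b - rampStep 1 2 a' * trapezoid (-1) 3 b'| ≤
      |a - a'| + |b - b'| := by
    refine (abs_mul_sub_mul_le _ _ _ _).trans (add_le_add ?_ ?_)
    · rw [abs_of_nonneg (trapezoid_nonneg _ _ b)]
      exact (mul_le_of_le_one_right (abs_nonneg _) (trapezoid_le_one _ _ b)).trans
        (abs_rampStep_sub_le (by norm_num) a a')
    · rw [abs_of_nonneg (rampStep_nonneg (by norm_num) a')]
      refine (mul_le_of_le_one_left (abs_nonneg _) ?_).trans (abs_trapezoid_sub_le _ _ b b')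
      linarith [rampStep_le (a := 1) (b := 2) (by norm_num) a']
  have hnext : |trapezoid 1 2 b * rampStep (-1) 3 c - trapezoid 1 2 b' * rampStep (-1) 3 c'| ≤
      4 * |b - b'| + |c - c'| := by
    refine (abs_mul_sub_mul_le _ _ _ _).trans (add_le_add ?_ ?_)
    · rw [abs_of_nonneg (rampStep_nonneg (by norm_num) c), mul_comm]
      refine mul_le_mul ?_ (abs_trapezoid_sub_le _ _ b b') (abs_nonneg _) (by norm_num)
      linarith [rampStep_le (a := -1) (b := 3) (by norm_num) c]
    · rw [abs_of_nonneg (trapezoid_nonneg _ _ b')]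
      exact (mul_le_of_le_one_left (abs_nonneg _) (trapezoid_le_one _ _ b')).trans
        (abs_rampStep_sub_le (by norm_num) c c')
  unfold chainPartial
  grind

theorem neg_four_le_link (a b : ℝ) : -4 ≤ link a b := by
  have hmul := mul_le_mul (rampStep_le (a := 1) (b := 2) (by norm_num) a)
    (rampStep_le (a := -1) (b := 3) (by norm_num) b) (rampStep_nonneg (by norm_num) b)
    (by norm_num)
  unfold link
  linarith [sqRamp_nonneg (-b)]

theorem link_zero_nonpos (a : ℝ) : link a 0 ≤ 0 := by
  have hmul := mul_nonneg (rampStep_nonneg (a := 1) (b := 2) (by norm_num) a)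
    (rampStep_nonneg (a := -1) (b := 3) (by norm_num) 0)
  rw [link, sqRamp_of_nonpos (by simp)]
  linarith

theorem contDiff_link_node (n : ℕ) :
    ContDiff ℝ 1 fun x : Vec d => link (node x n) (node x (n + 1)) :=
  (contDiff_sqRamp.comp (contDiff_node (n + 1)).neg).sub
    (((contDiff_rampStep 1 2).comp (contDiff_node n)).mul
      ((contDiff_rampStep (-1) 3).comp (contDiff_node (n + 1))))

theorem hasFDerivAt_link_node (x : Vec d) (n : ℕ) :
    HasFDerivAt (fun x : Vec d => link (node x n) (node x (n + 1)))
      ((min (node x (n + 1)) 0 - rampStep 1 2 (node x n) * trapezoid (-1) 3 (node x (n + 1))) •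
          nodeLinear d (n + 1) -
        (trapezoid 1 2 (node x n) * rampStep (-1) 3 (node x (n + 1))) • nodeLinear d n) x := by
  have hprev := (hasDerivAt_rampStep (a := 1) (b := 2) (by norm_num) (node x n)).comp_hasFDerivAt x
    (hasFDerivAt_node x n)
  have hnext := (hasDerivAt_rampStep (a := -1) (b := 3) (by norm_num)
    (node x (n + 1))).comp_hasFDerivAt x (hasFDerivAt_node x (n + 1))
  have hsq := (hasDerivAt_sqRamp (-node x (n + 1))).comp_hasFDerivAt x
    (hasFDerivAt_node x (n + 1)).neg
  refine (hsq.sub (hprev.mul hnext)).congr_fderiv ?_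
  rw [show max (-node x (n + 1)) 0 = -min (node x (n + 1)) 0 by grind]
  simp only [Function.comp_apply]
  module

theorem contDiff_chain : ContDiff ℝ 1 (chain d) := ContDiff.sum fun n _ => contDiff_link_node n

theorem hasGradientAt_chain (x : Vec d) : HasGradientAt (chain d) (chainGrad x) x := by
  rw [hasGradientAt_iff_hasFDerivAt]
  refine (HasFDerivAt.fun_sum fun n _ => hasFDerivAt_link_node x n).congr_fderiv ?_
  ext v
  simp only [Finset.sum_sub_distrib]
  rw [Finset.sum_range_succ, Finset.sum_range_succ' fun n => (trapezoid 1 2 (node x n) * _) • _,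
    nodeLinear_add_one_self, nodeLinear_zero, smul_zero, smul_zero, add_zero, add_zero,
    ← Finset.sum_sub_distrib, Finset.sum_range]
  simp only [sum_apply, sub_apply, smul_apply, smul_eq_mul, InnerProductSpace.toDual_apply_apply,
    PiLp.inner_apply, chainGrad, nodeLinear_succ, chainPartial, RCLike.inner_apply, conj_trivial]
  exact Finset.sum_congr rfl fun i _ => by ring

theorem neg_le_chain (x : Vec d) : -(4 * ((d : ℝ) + 1)) ≤ chain d x := by
  have hsum := Finset.card_nsmul_le_sum (Finset.range (d + 1)) _ _
    fun n _ => neg_four_le_link (node x n) (node x (n + 1))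
  rw [Finset.card_range, nsmul_eq_mul, Nat.cast_succ] at hsum
  unfold chain
  linarith

theorem chain_zero_nonpos : chain d 0 ≤ 0 :=
  Finset.sum_nonpos fun n _ => by
    rw [node_eq_zero (zero_mem (stdFlag d 0)) n.succ_pos]
    exact link_zero_nonpos _

theorem norm_chainGrad_sub_le (x y : Vec d) : ‖chainGrad x - chainGrad y‖ ≤ 8 * ‖x - y‖ := by
  refine le_of_sq_le_sq ?_ (by positivity)
  set D : ℕ → ℝ := fun n => nodeLinear d n (x - y)
  have hcoord (i : Fin d) : ‖(chainGrad x - chainGrad y) i‖ ^ 2 ≤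
      8 * (D (i + 0) ^ 2 + 6 * D (i + 1) ^ 2 + D (i + 2) ^ 2) := by
    have hle := abs_chainPartial_sub_le (node x i) (node x (i + 1)) (node x (i + 2))
      (node y i) (node y (i + 1)) (node y (i + 2))
    simp only [node_sub] at hle
    refine (pow_le_pow_left₀ (norm_nonneg _) hle 2).trans ?_
    rw [← sq_abs (D (i + 0)), ← sq_abs (D (i + 1)), ← sq_abs (D (i + 2)), add_zero]
    nlinarith [sq_nonneg (|D i| - |D (i + 1)|), sq_nonneg (|D i| - |D (i + 2)|),
      sq_nonneg (|D (i + 1)| - |D (i + 2)|)]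
  calc ‖chainGrad x - chainGrad y‖ ^ 2
      ≤ ∑ i : Fin d, 8 * (D (i + 0) ^ 2 + 6 * D (i + 1) ^ 2 + D (i + 2) ^ 2) := by
        rw [EuclideanSpace.norm_sq_eq]
        exact Finset.sum_le_sum fun i _ => hcoord i
    _ = 8 * (∑ i : Fin d, D (i + 0) ^ 2 + 6 * ∑ i : Fin d, D (i + 1) ^ 2 +
          ∑ i : Fin d, D (i + 2) ^ 2) := by
        rw [← Finset.mul_sum, Finset.sum_add_distrib, Finset.sum_add_distrib, ← Finset.mul_sum]
    _ ≤ (8 * ‖x - y‖) ^ 2 := by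
        linarith [sum_nodeLinear_add_sq_le 0 (x - y), sum_nodeLinear_add_sq_le 1 (x - y),
          sum_nodeLinear_add_sq_le 2 (x - y)]

theorem one_le_norm_chainGrad {x : Vec d} {n : ℕ} (hn : n < d) (hx : x ∈ stdFlag d n) :
    1 ≤ ‖chainGrad x‖ := by
  obtain ⟨m, hmd, hm, hm'⟩ : ∃ m < d, 3 ≤ node x m ∧ node x (m + 1) ≤ 3 := by
    by_contra! hcon
    have hall : ∀ m ≤ d, 3 ≤ node x m := by
      intro m
      induction m with
      | zero => simp
      | succ m ih => exact fun hm => (hcon m hm (ih (Nat.le_of_lt hm))).le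
    linarith [hall d le_rfl, node_eq_zero hx hn]
  calc (1 : ℝ) ≤ -chainGrad x ⟨m, hmd⟩ := le_neg_of_le_neg (chainPartial_le_neg_one hm hm' _)
    _ ≤ ‖chainGrad x ⟨m, hmd⟩‖ := neg_le_abs _
    _ ≤ ‖chainGrad x‖ := PiLp.norm_apply_le _ _

theorem chainGrad_apply_of_mem_stdFlag {x : Vec d} {m : ℕ} (hx : x ∈ stdFlag d m) {i : Fin d}
    (hi : m ≤ i) : chainGrad x i = -rampStep 1 2 (node x i) := by
  change chainPartial _ _ _ = _
  rw [node_eq_zero hx (Nat.lt_succ_of_le hi), chainPartial_zero]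

theorem revealsAtMost_chainGrad : RevealsAtMost (chainGrad (d := d)) 1 := by
  intro x m hx i hi
  rw [chainGrad_apply_of_mem_stdFlag hx (by omega), node_eq_zero hx hi,
    rampStep_of_le (by norm_num) zero_le_one, neg_zero]

end Chain

section ProgressMask

variable {d : ℕ}

theorem norm_sq_le_ncard_vecSupport_mul_sq {v : Vec d} {c : ℝ} (hv : ∀ i, |v i| ≤ c) :
    ‖v‖ ^ 2 ≤ (vecSupport v).ncard * c ^ 2 := by
  classical
  have hsupp : vecSupport v = ((Finset.univ.filter fun i => v i ≠ 0 : Finset (Fin d)) :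
      Set (Fin d)) := by
    ext i
    simp [vecSupport]
  rw [hsupp, Set.ncard_coe_finset, EuclideanSpace.norm_sq_eq,
    ← Finset.sum_filter_of_ne (p := fun i => v i ≠ 0) (by simp), ← nsmul_eq_mul]
  exact Finset.sum_le_card_nsmul _ _ _ fun i _ => pow_le_pow_left₀ (norm_nonneg _) (hv i) 2

theorem vecSupport_sub_subset (v w : Vec d) :
    vecSupport (v - w) ⊆ vecSupport v ∪ vecSupport w := by
  intro i hi
  by_contra hcon
  simp only [vecSupport, Set.mem_union, Set.mem_ofPred_eq, not_or, not_not] at hcon hi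
  exact hi (by simp [hcon.1, hcon.2])

/-- The largest modulus of a coordinate with index at least `i`. -/
def tailNorm (x : Vec d) (i : Fin d) : ℝ := ‖(Set.Ici i).domRestrict x.ofLp‖

theorem tailNorm_nonneg (x : Vec d) (i : Fin d) : 0 ≤ tailNorm x i := norm_nonneg _

theorem abs_le_tailNorm (x : Vec d) {i j : Fin d} (hij : i ≤ j) : |x j| ≤ tailNorm x i :=
  norm_le_pi_norm ((Set.Ici i).domRestrict x.ofLp) ⟨j, hij⟩

theorem tailNorm_eq_zero {x : Vec d} {m : ℕ} (hx : x ∈ stdFlag d m) {i : Fin d} (hi : m ≤ i) :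
    tailNorm x i = 0 :=
  norm_eq_zero.2 (funext fun j => hx j (hi.trans j.2))

theorem abs_tailNorm_sub_le (x y : Vec d) (i : Fin d) :
    |tailNorm x i - tailNorm y i| ≤ ‖x - y‖ :=
  (abs_norm_sub_norm_le _ _).trans
    ((pi_norm_le_iff_of_nonneg (norm_nonneg _)).2 fun j => PiLp.norm_apply_le (x - y) j)

theorem node_le_tailNorm (x : Vec d) {i j : Fin d} (hij : i < j) : node x j ≤ tailNorm x i := by
  obtain ⟨k, hk⟩ : ∃ k : Fin d, (k : ℕ) + 1 = j := ⟨⟨j - 1, by omega⟩, by grind⟩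
  rw [← hk, node_succ]
  exact (le_abs_self _).trans (abs_le_tailNorm x (by grind))

/-- The part of the gradient of `chain` that reveals the next coordinate: it agrees with `chainGrad`
in every coordinate beyond the last nonzero one of `x`. The cutoff confines its support to a single
coordinate. -/
def chainNoise (x : Vec d) : Vec d :=
  WithLp.toLp 2 fun i => -(rampStep 1 2 (node x i) * max 0 (1 - tailNorm x i))

theorem chainNoise_apply (x : Vec d) (i : Fin d) :
    chainNoise x i = -(rampStep 1 2 (node x i) * max 0 (1 - tailNorm x i)) := rfl

theorem abs_cutoff_le_one (x : Vec d) (i : Fin d) : |max 0 (1 - tailNorm x i)| ≤ 1 := by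
  grind [tailNorm_nonneg x i]

theorem abs_chainNoise_le_one (x : Vec d) (i : Fin d) : |chainNoise x i| ≤ 1 := by
  have hstep : |rampStep 1 2 (node x i)| ≤ 1 := by
    rw [abs_of_nonneg (rampStep_nonneg (by norm_num) _)]
    linarith [rampStep_le (a := 1) (b := 2) (by norm_num) (node x i)]
  rw [chainNoise_apply, abs_neg, abs_mul]
  exact mul_le_one₀ hstep (abs_nonneg _) (abs_cutoff_le_one x i)

theorem abs_nodeLinear_le (v : Vec d) (n : ℕ) : |nodeLinear d n v| ≤ ‖v‖ :=
  abs_le_of_sq_le_sq (by simpa using sum_nodeLinear_sq_le {n} v) (norm_nonneg v)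

theorem abs_chainNoise_sub_le (x y : Vec d) (i : Fin d) :
    |(chainNoise x - chainNoise y) i| ≤ 2 * ‖x - y‖ := by
  have hstep : |rampStep 1 2 (node x i) - rampStep 1 2 (node y i)| ≤ ‖x - y‖ :=
    (abs_rampStep_sub_le (by norm_num) _ _).trans (node_sub x y i ▸ abs_nodeLinear_le (x - y) i)
  have hcut : |max 0 (1 - tailNorm x i) - max 0 (1 - tailNorm y i)| ≤ ‖x - y‖ := by
    refine le_trans ?_ (abs_tailNorm_sub_le x y i)
    grind
  have hle_one : |rampStep 1 2 (node y i)| ≤ 1 := by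
    rw [abs_of_nonneg (rampStep_nonneg (by norm_num) _)]
    linarith [rampStep_le (a := 1) (b := 2) (by norm_num) (node y i)]
  rw [PiLp.sub_apply, chainNoise_apply, chainNoise_apply, neg_sub_neg, abs_sub_comm]
  calc |rampStep 1 2 (node x i) * max 0 (1 - tailNorm x i) -
        rampStep 1 2 (node y i) * max 0 (1 - tailNorm y i)|
      ≤ ‖x - y‖ * 1 + 1 * ‖x - y‖ := (abs_mul_sub_mul_le _ _ _ _).trans
        (add_le_add (mul_le_mul hstep (abs_cutoff_le_one x i) (abs_nonneg _) (norm_nonneg _))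
          (mul_le_mul hle_one hcut (abs_nonneg _) zero_le_one))
    _ = 2 * ‖x - y‖ := by ring

/-- If `i < j` and the noise at `j` is nonzero, the predecessor of `j` exceeds `1`, which switches
off the noise at `i`. -/
theorem subsingleton_vecSupport_chainNoise (x : Vec d) :
    (vecSupport (chainNoise x)).Subsingleton := by
  have hlt {i j : Fin d} (hij : i < j) (hi : chainNoise x i ≠ 0) : chainNoise x j = 0 := by
    rw [chainNoise_apply] at hi ⊢
    have hnode : node x j ≤ 1 := by
      contrapose! hi
      have htail : 1 < tailNorm x i := hi.trans_le (node_le_tailNorm x hij)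
      rw [max_eq_left (by linarith), mul_zero, neg_zero]
    rw [rampStep_of_le (by norm_num) hnode, zero_mul, neg_zero]
  intro i hi j hj
  by_contra hne
  rcases lt_or_gt_of_ne hne with hij | hji
  · exact hj (hlt hij hi)
  · exact hi (hlt hji hj)

theorem norm_chainNoise_le_one (x : Vec d) : ‖chainNoise x‖ ≤ 1 := by
  have hcard : ((vecSupport (chainNoise x)).ncard : ℝ) ≤ 1 := by
    exact_mod_cast Set.ncard_le_one_iff_subsingleton.2 (subsingleton_vecSupport_chainNoise x)
  have hnorm := norm_sq_le_ncard_vecSupport_mul_sq (abs_chainNoise_le_one x)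
  exact le_of_sq_le_sq (by linarith) zero_le_one

theorem norm_chainNoise_sub_le (x y : Vec d) : ‖chainNoise x - chainNoise y‖ ≤ 3 * ‖x - y‖ := by
  have hcard : ((vecSupport (chainNoise x - chainNoise y)).ncard : ℝ) ≤ 2 := by
    have hx := Set.ncard_le_one_iff_subsingleton.2 (subsingleton_vecSupport_chainNoise x)
    have hy := Set.ncard_le_one_iff_subsingleton.2 (subsingleton_vecSupport_chainNoise y)
    exact_mod_cast (Set.ncard_le_ncard (vecSupport_sub_subset _ _)).trans
      ((Set.ncard_union_le _ _).trans (add_le_add hx hy))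
  refine le_of_sq_le_sq ?_ (by positivity)
  calc ‖chainNoise x - chainNoise y‖ ^ 2
      ≤ (vecSupport (chainNoise x - chainNoise y)).ncard * (2 * ‖x - y‖) ^ 2 :=
        norm_sq_le_ncard_vecSupport_mul_sq (abs_chainNoise_sub_le x y)
    _ ≤ 2 * (2 * ‖x - y‖) ^ 2 := by gcongr
    _ ≤ (3 * ‖x - y‖) ^ 2 := by nlinarith [sq_nonneg ‖x - y‖]

theorem revealsAtMost_chainGrad_sub_chainNoise :
    RevealsAtMost (fun x : Vec d => chainGrad x - chainNoise x) 0 := by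
  intro x m hx i hi
  rw [PiLp.sub_apply, chainGrad_apply_of_mem_stdFlag hx hi, chainNoise_apply,
    tailNorm_eq_zero hx hi]
  simp

/-- A field bounded by `1` and `ℓ`-Lipschitz whose removal from `G` leaves a field that reveals no
new coordinate. -/
structure IsProgressMask (G N : Vec d → Vec d) (ℓ : ℝ) : Prop where
  norm_le_one : ∀ x, ‖N x‖ ≤ 1
  norm_sub_le : ∀ x y, ‖N x - N y‖ ≤ ℓ * ‖x - y‖
  revealsAtMost_sub : RevealsAtMost (fun x => G x - N x) 0

theorem isProgressMask_chainNoise : IsProgressMask (chainGrad (d := d)) chainNoise 3 :=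
  ⟨norm_chainNoise_le_one, norm_chainNoise_sub_le, revealsAtMost_chainGrad_sub_chainNoise⟩

theorem isProgressMask_chainNoise_zero :
    IsProgressMask (chainGrad (d := 1)) (fun _ => chainNoise 0) 0 where
  norm_le_one _ := norm_chainNoise_le_one 0
  norm_sub_le x y := by simp
  revealsAtMost_sub x m hx i hi := by
    obtain rfl : x = 0 := PiLp.ext fun j => hx j (by omega)
    exact revealsAtMost_chainGrad_sub_chainNoise hx i hi

end ProgressMask

section Rescaling

variable {d : ℕ}

theorem continuous_gradient {F : Vec d → ℝ} (hF : ContDiff ℝ 1 F) : Continuous (gradient F) :=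
  (InnerProductSpace.toDual ℝ (Vec d)).symm.continuous.comp (hF.continuous_fderiv one_ne_zero)

theorem hasGradientAt_const_mul_comp_smul {F : Vec d → ℝ} {g x : Vec d} (a c : ℝ)
    (hF : HasGradientAt F g (c • x)) :
    HasGradientAt (fun x => a * F (c • x)) ((a * c) • g) x := by
  rw [hasGradientAt_iff_hasFDerivAt] at hF ⊢
  refine ((hF.comp x ((hasFDerivAt_id x).const_smul c)).const_mul a).congr_fderiv ?_
  ext v
  simp [mul_assoc]

theorem norm_smul_comp_smul_sub_le {G : Vec d → Vec d} {ℓ : ℝ}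
    (hG : ∀ x y, ‖G x - G y‖ ≤ ℓ * ‖x - y‖) {a c : ℝ} (ha : 0 ≤ a) (hc : 0 ≤ c) (x y : Vec d) :
    ‖a • G (c • x) - a • G (c • y)‖ ≤ a * ℓ * c * ‖x - y‖ := by
  have hxy := hG (c • x) (c • y)
  rw [← smul_sub, norm_smul, Real.norm_of_nonneg hc] at hxy
  rw [← smul_sub, norm_smul, Real.norm_of_nonneg ha]
  calc a * ‖G (c • x) - G (c • y)‖ ≤ a * (ℓ * (c * ‖x - y‖)) := by gcongr
    _ = a * ℓ * c * ‖x - y‖ := by ring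

/-- The chain rescaled to an `L`-Lipschitz gradient of norm at least `2 * ε` before the last
coordinate is reached. -/
def hardFunction (d : ℕ) (ε L : ℝ) (x : Vec d) : ℝ :=
  32 * ε ^ 2 / L * chain d ((L / (16 * ε)) • x)

variable {ε L : ℝ}

theorem contDiff_hardFunction (d : ℕ) (ε L : ℝ) : ContDiff ℝ 1 (hardFunction d ε L) :=
  contDiff_const.mul (contDiff_chain.comp (contDiff_id.const_smul (L / (16 * ε))))

theorem gradient_hardFunction (hε : 0 < ε) (hL : 0 < L) :
    gradient (hardFunction d ε L) = fun x => (2 * ε) • chainGrad ((L / (16 * ε)) • x) := by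
  have hcoef : 32 * ε ^ 2 / L * (L / (16 * ε)) = 2 * ε := by
    field_simp
    norm_num
  ext1 x
  rw [← hcoef]
  exact (hasGradientAt_const_mul_comp_smul _ _ (hasGradientAt_chain _)).gradient

theorem hardFunction_mem_functionClass (hd : 1 ≤ d) (hε : 0 < ε) (hL : 0 < L) {Δ : ℝ}
    (hΔ : 256 * ε ^ 2 * d ≤ L * Δ) : hardFunction d ε L ∈ FunctionClass d Δ L := by
  have hlow (x : Vec d) : -Δ ≤ hardFunction d ε L x := by
    have hd' : (1 : ℝ) ≤ d := by exact_mod_cast hd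
    calc -Δ ≤ -(256 * ε ^ 2 * d / L) := neg_le_neg ((div_le_iff₀' hL).2 hΔ)
      _ = 32 * ε ^ 2 / L * -(4 * (d + d)) := by ring
      _ ≤ 32 * ε ^ 2 / L * -(4 * (d + 1)) := by gcongr
      _ ≤ hardFunction d ε L x := by
        unfold hardFunction
        gcongr
        exact neg_le_chain _
  have hzero : hardFunction d ε L 0 ≤ 0 := by
    rw [hardFunction, smul_zero]
    exact mul_nonpos_of_nonneg_of_nonpos (by positivity) chain_zero_nonpos
  refine ⟨contDiff_hardFunction d ε L, ⟨-Δ, Set.forall_mem_range.2 hlow⟩, ?_, fun x y => ?_⟩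
  · linarith [le_ciInf hlow]
  · rw [gradient_hardFunction hε hL]
    refine (norm_smul_comp_smul_sub_le norm_chainGrad_sub_le (by positivity) (by positivity)
      x y).trans_eq ?_
    field_simp
    norm_num

theorem revealsAtMost_gradient_hardFunction (hε : 0 < ε) (hL : 0 < L) :
    RevealsAtMost (gradient (hardFunction d ε L)) 1 := by
  rw [gradient_hardFunction hε hL]
  exact revealsAtMost_chainGrad.smul_comp_smul _ _

theorem le_norm_gradient_hardFunction (hε : 0 < ε) (hL : 0 < L) {n : ℕ} (hn : n < d) {x : Vec d}
    (hx : x ∈ stdFlag d n) : 2 * ε ≤ ‖gradient (hardFunction d ε L) x‖ := by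
  have hscaled := one_le_norm_chainGrad hn (Submodule.smul_mem _ (L / (16 * ε)) hx)
  rw [gradient_hardFunction hε hL, norm_smul, Real.norm_of_nonneg (by positivity)]
  exact le_mul_of_one_le_right (by positivity) hscaled

end Rescaling

section HardInstance

/-- There is an admissible function and oracle against which every zero-respecting algorithm needs
at least `X` rounds. -/
def HasHardInstance (K : ℕ) (p q ε L₁ Δ δ σ₁ X : ℝ) : Prop :=
  ∃ d : ℕ, 1 ≤ d ∧ ∃ F ∈ FunctionClass d Δ L₁, ∃ O ∈ OracleClass F p σ₁ q δ,
    ∀ A ∈ ZeroRespectingClass.{u} d K, ENNReal.ofReal X ≤ A.complexity O ε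

variable {K d : ℕ} {p q ε L L₁ Δ δ σ₁ X Y θ : ℝ}

namespace HasHardInstance

theorem mono (h : HasHardInstance.{u} K p q ε L₁ Δ δ σ₁ X) (hYX : Y ≤ X) :
    HasHardInstance.{u} K p q ε L₁ Δ δ σ₁ Y :=
  let ⟨d, hd, F, hF, O, hO, hA⟩ := h
  ⟨d, hd, F, hF, O, hO, fun A hAmem => (ENNReal.ofReal_le_ofReal hYX).trans (hA A hAmem)⟩

theorem mono_lipschitz (h : HasHardInstance.{u} K p q ε L Δ δ σ₁ X) (hL : L ≤ L₁) :
    HasHardInstance.{u} K p q ε L₁ Δ δ σ₁ X :=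
  let ⟨d, hd, F, ⟨hF, hbdd, hΔ, hlip⟩, hO⟩ := h
  ⟨d, hd, F, ⟨hF, hbdd, hΔ, fun x y =>
    (hlip x y).trans (mul_le_mul_of_nonneg_right hL (norm_nonneg _))⟩, hO⟩

theorem sup (hX : HasHardInstance.{u} K p q ε L₁ Δ δ σ₁ X)
    (hY : HasHardInstance.{u} K p q ε L₁ Δ δ σ₁ Y) :
    HasHardInstance.{u} K p q ε L₁ Δ δ σ₁ (X ⊔ Y) := by
  rcases max_choice X Y with h | h
  · rwa [h]
  · rwa [h]

theorem le_zeroRespectingComplexity (h : HasHardInstance.{u} K p q ε L₁ Δ δ σ₁ X) :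
    ENNReal.ofReal X ≤ zeroRespectingComplexity.{u} K p q ε L₁ Δ δ σ₁ :=
  let ⟨d, hd, F, hF, O, hO, hA⟩ := h
  le_iSup₂_of_le d hd (le_iSup₂_of_le F hF (le_iSup₂_of_le O hO (le_iInf₂ hA)))

end HasHardInstance

theorem hasHardInstance_exact (hp : 0 < p) (hq : 0 < q) (hε : 0 < ε) (hL : 0 < L) (hd : 1 ≤ d)
    (hΔ : 256 * ε ^ 2 * d ≤ L * Δ) : HasHardInstance.{u} K p q ε L Δ δ σ₁ (d / 2) :=
  have hF := contDiff_hardFunction d ε L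
  ⟨d, hd, _, hardFunction_mem_functionClass hd hε hL hΔ,
    .exact (continuous_gradient hF), StochasticOracle.exact_mem_oracleClass _ hp hq σ₁ δ,
    fun _ hA => StochasticOracle.ofReal_half_le_complexity_exact hF _ hε
      (revealsAtMost_gradient_hardFunction hε hL)
      (fun _ hn _ hx => le_norm_gradient_hardFunction hε hL hn hx) hA⟩

theorem hasHardInstance_of_isProgressMask {N : Vec d → Vec d} {ℓ : ℝ}
    (hN : IsProgressMask chainGrad N ℓ) (hℓ : 0 ≤ ℓ) (hp : 1 ≤ p) (hq : 1 ≤ q) (hε : 0 < ε)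
    (hL : 0 < L) (hd : 1 ≤ d) (hΔ : 256 * ε ^ 2 * d ≤ L * Δ) (hθ : θ ∈ Set.Ioc 0 1)
    (hσ : 2 * (2 * ε) ^ p * θ ^ (1 - p) ≤ σ₁ ^ p)
    (hδ : 2 * (ℓ * L / 8) ^ q * θ ^ (1 - q) ≤ δ ^ q) :
    HasHardInstance.{u} K p q ε L Δ δ σ₁ (d / (2 * θ)) := by
  set M : Vec d → Vec d := fun x => (2 * ε) • N ((L / (16 * ε)) • x)
  have hbound (x : Vec d) : ‖M x‖ ≤ 2 * ε := by
    rw [norm_smul, Real.norm_of_nonneg (by positivity)]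
    exact mul_le_of_le_one_right (by positivity) (hN.norm_le_one _)
  have hlip (x y : Vec d) : ‖M x - M y‖ ≤ ℓ * L / 8 * ‖x - y‖ := by
    refine (norm_smul_comp_smul_sub_le hN.norm_sub_le (by positivity) (by positivity)
      x y).trans_eq ?_
    field_simp
    ring
  have hM : Continuous M :=
    (LipschitzWith.of_dist_le' fun x y => by simpa only [dist_eq_norm] using hlip x y).continuous
  have hmask : RevealsAtMost (fun x => gradient (hardFunction d ε L) x - M x) 0 := by
    simp only [gradient_hardFunction hε hL, M, ← smul_sub]
    exact hN.revealsAtMost_sub.smul_comp_smul _ _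
  have hF := contDiff_hardFunction d ε L
  exact ⟨d, hd, _, hardFunction_mem_functionClass hd hε hL hΔ,
    .bernoulli (continuous_gradient hF) hM (θ := ⟨θ, hθ.1.le, hθ.2⟩) hθ.1,
    StochasticOracle.bernoulli_mem_oracleClass _ hM hθ.1 hp hq (by positivity) hbound hlip hσ hδ,
    fun _ hA => StochasticOracle.ofReal_div_le_complexity_bernoulli hF _ hM hθ.1 hε
      (revealsAtMost_gradient_hardFunction hε hL) hmask
      (fun _ hn _ hx => le_norm_gradient_hardFunction hε hL hn hx) hA⟩

theorem exists_chain_length (hε : 0 < ε) (h : 256 ≤ L * Δ / ε ^ 2) :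
    ∃ d : ℕ, 1 ≤ d ∧ 256 * ε ^ 2 * d ≤ L * Δ ∧ L * Δ / ε ^ 2 / 512 ≤ d := by
  set t := L * Δ / ε ^ 2 / 256 with ht
  have hone : 1 ≤ ⌊t⌋₊ := Nat.one_le_floor_iff _ |>.2 (by linarith)
  refine ⟨⌊t⌋₊, hone, ?_, ?_⟩
  · calc 256 * ε ^ 2 * (⌊t⌋₊ : ℝ) ≤ 256 * ε ^ 2 * t := by
          gcongr
          exact Nat.floor_le (by linarith)
      _ = L * Δ := by
          rw [ht]
          field_simp
  · have hlt := Nat.lt_floor_add_one t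
    have hone' : (1 : ℝ) ≤ (⌊t⌋₊ : ℝ) := by exact_mod_cast hone
    linarith

theorem hasHardInstance_noiseless (hp : 0 < p) (hq : 0 < q) (hε : 0 < ε) (hL : 0 < L)
    (h : 256 ≤ L * Δ / ε ^ 2) : HasHardInstance.{u} K p q ε L Δ δ σ₁ (L * Δ / ε ^ 2 / 1024) :=
  let ⟨_, hd, hΔ, hlen⟩ := exists_chain_length hε h
  (hasHardInstance_exact hp hq hε hL hd hΔ).mono (by linarith)

theorem hasHardInstance_single (hp : 1 ≤ p) (hq : 1 ≤ q) (hε : 0 < ε) (hL : 0 < L) (hδ : 0 ≤ δ)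
    (hθ : θ ∈ Set.Ioc 0 1) (hσ : 2 * (2 * ε) ^ p * θ ^ (1 - p) ≤ σ₁ ^ p)
    (h : 256 ≤ L * Δ / ε ^ 2) : HasHardInstance.{u} K p q ε L Δ δ σ₁ (1 / (2 * θ)) := by
  have hΔ : 256 * ε ^ 2 * (1 : ℕ) ≤ L * Δ := by
    simpa using (le_div_iff₀ (by positivity)).1 h
  have hδq : 2 * (0 * L / 8) ^ q * θ ^ (1 - q) ≤ δ ^ q := by
    rw [zero_mul, zero_div, Real.zero_rpow (by positivity), mul_zero, zero_mul]
    positivity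
  simpa using hasHardInstance_of_isProgressMask isProgressMask_chainNoise_zero le_rfl hp hq hε hL
    le_rfl hΔ hθ hσ hδq

theorem two_mul_three_mul_div_eight_rpow_le (hL : 0 ≤ L) (hq : 1 ≤ q) :
    2 * (3 * L / 8) ^ q ≤ L ^ q := by
  have hpow : (3 / 8 : ℝ) ^ q ≤ 3 / 8 := by
    simpa using Real.rpow_le_rpow_of_exponent_ge (x := 3 / 8) (by norm_num) (by norm_num) hq
  have hLq := Real.rpow_nonneg hL q
  rw [show 3 * L / 8 = 3 / 8 * L by ring, Real.mul_rpow (by norm_num) hL]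
  nlinarith

theorem hasHardInstance_chain (hp : 1 ≤ p) (hq : 1 ≤ q) (hε : 0 < ε) (hL : 0 < L)
    (hθ : θ ∈ Set.Ioc 0 1) (hσ : 2 * (2 * ε) ^ p * θ ^ (1 - p) ≤ σ₁ ^ p)
    (hδ : L ^ q * θ ^ (1 - q) ≤ δ ^ q) (h : 256 ≤ L * Δ / ε ^ 2) :
    HasHardInstance.{u} K p q ε L Δ δ σ₁ (L * Δ / ε ^ 2 / (1024 * θ)) := by
  obtain ⟨d, hd, hΔ, hlen⟩ := exists_chain_length hε h
  have hθ0 : 0 < θ := hθ.1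
  have hδq : 2 * (3 * L / 8) ^ q * θ ^ (1 - q) ≤ δ ^ q :=
    (mul_le_mul_of_nonneg_right (two_mul_three_mul_div_eight_rpow_le hL.le hq)
      (by positivity)).trans hδ
  refine (hasHardInstance_of_isProgressMask isProgressMask_chainNoise (by norm_num) hp hq hε hL hd
    hΔ hθ hσ hδq).mono ?_
  calc L * Δ / ε ^ 2 / (1024 * θ) = L * Δ / ε ^ 2 / 512 / (2 * θ) := by ring
    _ ≤ d / (2 * θ) := by gcongr

end HardInstance

section Rates

variable {K : ℕ} {p q ε L₁ Δ δ σ₁ s B θ : ℝ}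

/-- The scale `B` of the reveal probability `θ = B * (σ₁ / ε) ^ (-p / (p - 1))`, chosen so that the
bound `2 * (2 * ε) ^ p * θ ^ (1 - p)` on the `p`-th moment of the masking noise equals `σ₁ ^ p`. -/
def maskingConst (p : ℝ) : ℝ :=
  2 ^ ((p + 1) / (p - 1))

theorem maskingConst_pos (p : ℝ) : 0 < maskingConst p := by
  unfold maskingConst
  positivity

theorem one_le_maskingConst (hp : 1 < p) : 1 ≤ maskingConst p :=
  Real.one_le_rpow one_le_two (div_nonneg (by linarith) (by linarith))

theorem two_mul_two_mul_rpow_mul_maskingConst_div_rpow (hp : 1 < p) (hε : 0 < ε) (hσ : 0 < σ₁) :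
    2 * (2 * ε) ^ p * (maskingConst p / (σ₁ / ε) ^ (p / (p - 1))) ^ (1 - p) = σ₁ ^ p := by
  have hp0 : p - 1 ≠ 0 := by linarith
  have hB : maskingConst p ^ (1 - p) = (2 ^ p * 2)⁻¹ := by
    rw [maskingConst, ← Real.rpow_mul zero_le_two, ← Real.rpow_add_one two_ne_zero,
      ← Real.rpow_neg zero_le_two]
    congr 1
    field_simp
    ring
  have hs : ((σ₁ / ε) ^ (p / (p - 1))) ^ (1 - p) = (σ₁ ^ p / ε ^ p)⁻¹ := by
    rw [← Real.div_rpow hσ.le hε.le, ← Real.rpow_mul (by positivity),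
      ← Real.rpow_neg (by positivity)]
    congr 1
    field_simp
    ring
  rw [Real.div_rpow (maskingConst_pos p).le (by positivity), hB, hs,
    Real.mul_rpow zero_le_two hε.le]
  field_simp

theorem rpow_inv_le_div_rpow_mul (hs : 0 < s) (hB : 1 ≤ B) (hq : 1 ≤ q) :
    s ^ (1 / q) ≤ (B / s) ^ ((q - 1) / q) * s := by
  have : 0 ≤ (q - 1) / q := div_nonneg (by linarith) (by linarith)
  calc s ^ (1 / q) = s⁻¹ ^ ((q - 1) / q) * s := by
        rw [Real.inv_rpow hs.le, ← Real.rpow_neg hs.le, ← Real.rpow_add_one hs.ne']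
        congr 1
        field_simp
        ring
    _ ≤ (B / s) ^ ((q - 1) / q) * s := by
        rw [← one_div s]
        gcongr

/-- The smoothness constant of the hard function on the chain, masked with probability `1 - θ`: the
largest one compatible with both the smoothness of `F` and the smoothness of its oracle. -/
def chainLipschitz (q L₁ δ θ : ℝ) : ℝ :=
  min L₁ (δ * θ ^ ((q - 1) / q))

theorem chainLipschitz_rpow_mul_le (hq : 1 ≤ q) (hδ : 0 ≤ δ) (hθ : 0 < θ)
    (hL : 0 ≤ chainLipschitz q L₁ δ θ) :
    chainLipschitz q L₁ δ θ ^ q * θ ^ (1 - q) ≤ δ ^ q :=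
  calc chainLipschitz q L₁ δ θ ^ q * θ ^ (1 - q)
      ≤ (δ * θ ^ ((q - 1) / q)) ^ q * θ ^ (1 - q) := by
        gcongr
        exact min_le_right _ _
    _ = δ ^ q * (θ ^ (q - 1) * θ ^ (1 - q)) := by
        rw [Real.mul_rpow hδ (by positivity), ← Real.rpow_mul hθ.le,
          div_mul_cancel₀ _ (by positivity), mul_assoc]
    _ = δ ^ q := by
        rw [← Real.rpow_add hθ, sub_add_sub_cancel', sub_self, Real.rpow_zero, mul_one]

theorem lowerRate_le_add_chainLipschitz (hq : 1 ≤ q) (hL : 0 ≤ L₁) (hΔ : 0 ≤ Δ) (hδ : 0 ≤ δ)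
    (hσε : 0 ≤ σ₁ / ε) (hB : 1 ≤ B) (hBs : B ≤ (σ₁ / ε) ^ (p / (p - 1))) :
    lowerRate p q ε L₁ Δ δ σ₁ ≤ L₁ * Δ / ε ^ 2 + (σ₁ / ε) ^ (p / (p - 1)) +
      2 * (chainLipschitz q L₁ δ (B / (σ₁ / ε) ^ (p / (p - 1))) * Δ / ε ^ 2 *
        (σ₁ / ε) ^ (p / (p - 1))) := by
  set s := (σ₁ / ε) ^ (p / (p - 1)) with hs
  have hs1 : 1 ≤ s := hB.trans hBs
  have hs0 : 0 < s := by linarith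
  rcases min_choice L₁ (δ * (B / s) ^ ((q - 1) / q)) with h | h
  · rw [chainLipschitz, h]
    refine (min_le_left _ _).trans ?_
    have : 0 ≤ L₁ * Δ / ε ^ 2 * s := by positivity
    linarith
  · have hroot : (σ₁ / ε) ^ (p / (q * (p - 1))) = s ^ (1 / q) := by
      rw [hs, ← Real.rpow_mul hσε, div_mul_div_comm, mul_one, mul_comm q]
    have hone : 1 ≤ s ^ (1 / q) := Real.one_le_rpow hs1 (by positivity)
    have hb : 0 ≤ δ * Δ / ε ^ 2 := by positivity
    have hchain : δ * Δ / ε ^ 2 * s ^ (1 / q) ≤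
        δ * (B / s) ^ ((q - 1) / q) * Δ / ε ^ 2 * s :=
      calc _ ≤ δ * Δ / ε ^ 2 * ((B / s) ^ ((q - 1) / q) * s) := by
            gcongr
            exact rpow_inv_le_div_rpow_mul hs0 hB hq
        _ = _ := by ring
    rw [chainLipschitz, h]
    refine (min_le_right _ _).trans ?_
    rw [hroot, add_mul, add_div]
    have := le_mul_of_one_le_right hb hone
    linarith

end Rates

section LowerBound

variable {K : ℕ} {p q ε L₁ Δ δ σ₁ θ : ℝ}

theorem hasHardInstance_lowerRate_of_noise_le (hp : 1 < p) (hq : 0 < q) (hε : 0 < ε) (hL : 0 < L₁)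
    (h : 256 ≤ L₁ * Δ / ε ^ 2) (hs : (σ₁ / ε) ^ (p / (p - 1)) ≤ maskingConst p) :
    HasHardInstance.{u} K p q ε L₁ Δ δ σ₁
      (lowerRate p q ε L₁ Δ δ σ₁ / (4096 * maskingConst p)) := by
  refine (hasHardInstance_noiseless (by positivity) hq hε hL h).mono ?_
  have hB := one_le_maskingConst hp
  rw [div_le_iff₀ (by positivity)]
  refine (min_le_left _ _).trans ?_
  generalize L₁ * Δ / ε ^ 2 = a at *
  have hmul := mul_le_mul_of_nonneg_left hs (show 0 ≤ a by linarith)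
  nlinarith

theorem hasHardInstance_masked (hp : 1 ≤ p) (hq : 1 ≤ q) (hε : 0 < ε) (hL : 0 < L₁)
    (hΔ : 0 ≤ Δ) (hδ : 0 ≤ δ) (hθ : θ ∈ Set.Ioc 0 1)
    (hσ : 2 * (2 * ε) ^ p * θ ^ (1 - p) ≤ σ₁ ^ p) (h : 256 ≤ L₁ * Δ / ε ^ 2) :
    HasHardInstance.{u} K p q ε L₁ Δ δ σ₁
      (1 / (2 * θ) ⊔ chainLipschitz q L₁ δ θ * Δ / ε ^ 2 / (1024 * θ)) := by
  have hsingle := hasHardInstance_single.{u} (K := K) hp hq hε hL hδ hθ hσ h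
  have hθ0 : 0 < θ := hθ.1
  rcases lt_or_ge (chainLipschitz q L₁ δ θ * Δ / ε ^ 2) 256 with hQ | hQ
  · refine hsingle.mono (sup_le le_rfl ?_)
    rw [div_le_div_iff₀ (by positivity) (by positivity)]
    nlinarith
  · have hchain : 0 < chainLipschitz q L₁ δ θ := by
      by_contra! hneg
      have : chainLipschitz q L₁ δ θ * Δ / ε ^ 2 ≤ 0 := div_nonpos_of_nonpos_of_nonneg
        (mul_nonpos_of_nonpos_of_nonneg hneg hΔ) (by positivity)
      linarith
    exact hsingle.sup ((hasHardInstance_chain hp hq hε hchain hθ hσ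
      (chainLipschitz_rpow_mul_le hq hδ hθ0 hchain.le) hQ).mono_lipschitz (min_le_left _ _))

theorem hasHardInstance_lowerRate_of_le_noise (hp : 1 < p) (hq : 1 ≤ q) (hε : 0 < ε) (hL : 0 < L₁)
    (hΔ : 0 ≤ Δ) (hδ : 0 ≤ δ) (hσ : 0 < σ₁) (h : 256 ≤ L₁ * Δ / ε ^ 2)
    (hs : maskingConst p ≤ (σ₁ / ε) ^ (p / (p - 1))) :
    HasHardInstance.{u} K p q ε L₁ Δ δ σ₁
      (lowerRate p q ε L₁ Δ δ σ₁ / (4096 * maskingConst p)) := by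
  have hB := one_le_maskingConst hp
  have hrate := lowerRate_le_add_chainLipschitz hq hL.le hΔ hδ (by positivity) hB hs
  have hmoment := two_mul_two_mul_rpow_mul_maskingConst_div_rpow hp hε hσ
  set s := (σ₁ / ε) ^ (p / (p - 1))
  set B := maskingConst p
  have hs0 : 0 < s := by positivity
  have hθ : B / s ∈ Set.Ioc 0 1 := ⟨by positivity, (div_le_one hs0).2 hs⟩
  have hnoiseless := hasHardInstance_noiseless.{u} (K := K) (δ := δ) (σ₁ := σ₁)
    (zero_lt_one.trans hp) (zero_lt_one.trans_le hq) hε hL h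
  have hmasked := hasHardInstance_masked.{u} (K := K) hp.le hq hε hL hΔ hδ hθ hmoment.le h
  refine (hnoiseless.sup hmasked).mono ((div_le_iff₀ (by positivity)).2 (hrate.trans ?_))
  set a := L₁ * Δ / ε ^ 2
  set Q := chainLipschitz q L₁ δ (B / s) * Δ / ε ^ 2
  set M := a / 1024 ⊔ (1 / (2 * (B / s)) ⊔ Q / (1024 * (B / s)))
  have ha : a / 1024 ≤ M := le_sup_left
  have hs' : 1 / (2 * (B / s)) ≤ M := le_sup_left.trans le_sup_right
  have hQ : Q / (1024 * (B / s)) ≤ M := le_sup_right.trans le_sup_right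
  have hM : M ≤ M * B := le_mul_of_one_le_right (by linarith) hB
  rw [mul_div_assoc', div_div_eq_mul_div, div_le_iff₀ (by positivity)] at hs' hQ
  linarith

theorem hasHardInstance_lowerRate (hp : 1 < p) (hq : 1 ≤ q) (hε : 0 < ε) (hL : 0 < L₁)
    (hΔ : 0 ≤ Δ) (hδ : 0 ≤ δ) (hσ : 0 ≤ σ₁) (h : 256 ≤ L₁ * Δ / ε ^ 2) :
    HasHardInstance.{u} K p q ε L₁ Δ δ σ₁
      (lowerRate p q ε L₁ Δ δ σ₁ / (4096 * maskingConst p)) := by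
  rcases le_total ((σ₁ / ε) ^ (p / (p - 1))) (maskingConst p) with hs | hs
  · exact hasHardInstance_lowerRate_of_noise_le hp (zero_lt_one.trans_le hq) hε hL h hs
  · refine hasHardInstance_lowerRate_of_le_noise hp hq hε hL hΔ hδ (hσ.lt_of_ne' ?_) h hs
    rintro rfl
    have hexp : p / (p - 1) ≠ 0 := div_ne_zero (by linarith) (by linarith)
    rw [zero_div, Real.zero_rpow hexp] at hs
    exact (maskingConst_pos p).not_ge hs

end LowerBound

end

theorem theorem2_general :
    ∃ c₁ : ℝ, 0 < c₁ ∧ ∀ p : ℝ, 1 < p → ∃ C : ℝ, 0 < C ∧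
      ∀ (q : ℝ) (K : ℕ) (Δ L₁ δ σ₁ ε : ℝ), 1 ≤ q →
        0 < L₁ → 0 ≤ δ → 0 ≤ σ₁ → 0 < ε → ε ≤ c₁ * √(L₁ * Δ) →
          (∃ d : ℕ, 1 ≤ d ∧ ∃ F ∈ FunctionClass d Δ L₁, ∃ O ∈ OracleClass F p σ₁ q δ,
            ∀ A ∈ ZeroRespectingClass.{u} d K,
              ENNReal.ofReal (C * lowerRate p q ε L₁ Δ δ σ₁) ≤ A.complexity O ε) ∧
          ENNReal.ofReal (C * lowerRate p q ε L₁ Δ δ σ₁) ≤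
            zeroRespectingComplexity.{u} K p q ε L₁ Δ δ σ₁ := by
  refine ⟨1 / 16, by norm_num, fun p hp => ⟨(4096 * maskingConst p)⁻¹,
    inv_pos.2 (mul_pos (by norm_num) (maskingConst_pos p)),
    fun q K Δ L₁ δ σ₁ ε hq hL hδ hσ hε hεL => ?_⟩⟩
  have hLΔ : 0 < L₁ * Δ := Real.sqrt_pos.1 (by linarith)
  have hΔ : 0 ≤ Δ := (pos_of_mul_pos_right hLΔ hL.le).le
  have h256 : 256 ≤ L₁ * Δ / ε ^ 2 := by
    rw [le_div_iff₀ (by positivity)]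
    have hsq := pow_le_pow_left₀ hε.le hεL 2
    rw [mul_pow, Real.sq_sqrt hLΔ.le] at hsq
    linarith
  rw [inv_mul_eq_div]
  have hhard := hasHardInstance_lowerRate.{u} (K := K) hp hq hε hL hΔ hδ hσ h256
  exact ⟨hhard, hhard.le_zeroRespectingComplexity⟩

theorem theorem2 :
    ∃ c₁ : ℝ, 0 < c₁ ∧ ∀ p q : ℝ, 1 < p → p ≤ 2 → 1 ≤ q → q ≤ 2 →
      ∃ C : ℝ, 0 < C ∧ ∀ (K : ℕ) (Δ L₁ δ σ₁ ε : ℝ), 1 ≤ K →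
        0 < Δ → 0 < L₁ → 0 < δ → 0 ≤ σ₁ → 0 < ε → ε ≤ c₁ * √(L₁ * Δ) →
          (∃ d : ℕ, 1 ≤ d ∧ ∃ F ∈ FunctionClass d Δ L₁, ∃ O ∈ OracleClass F p σ₁ q δ,
            ∀ A ∈ ZeroRespectingClass.{u} d K,
              ENNReal.ofReal (C * lowerRate p q ε L₁ Δ δ σ₁) ≤ A.complexity O ε) ∧
          ENNReal.ofReal (C * lowerRate p q ε L₁ Δ δ σ₁) ≤
            zeroRespectingComplexity.{u} K p q ε L₁ Δ δ σ₁ := by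
  obtain ⟨c₁, hc₁, h⟩ := theorem2_general.{u}
  exact ⟨c₁, hc₁, fun p q hp _ hq _ => let ⟨C, hC, hle⟩ := h p hp
    ⟨C, hC, fun K Δ L₁ δ σ₁ ε _ _ hL hδ => hle q K Δ L₁ δ σ₁ ε hq hL hδ.le⟩⟩
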